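/- Let $n\ge 1$, $T>0$, $\sigma>0$, $P\ge 0$, and let $A,B,C$ be real $n\times n$ matrices. Put $$\mathcal O=\int_0^T e^{A^\top t}C^\top C e^{At}\,dt,\qquad \mathcal W(\Sigma)=\sum_{k=0}^{\infty}e^{AkT}B\Sigma B^\top e^{A^\top kT},$$ $$f(\Sigma)=\frac12\log_2\frac{\det(\sigma^2I+\mathcal O\,\mathcal W(\Sigma))}{\det(\sigma^2I+\mathcal O(\mathcal W(\Sigma)-B\Sigma B^\top))},$$ and let the information rate of the network $(A,B,C)$ with window $T$, noise variance $\sigma^2$ and power $P$ be $$\mathcal R_T=\frac1T\max\{f(\Sigma):\ \Sigma\in\mathbb R^{n\times n},\ \Sigma\succcurlyeq 0,\ \operatorname{tr}\Sigma\le P\}.$$ Suppose that $B=C=I$ and that $A$ is normal ($AA^\top=A^\top A$) and stable (all its complex eigenvalues have negative real part), and let $\lambda_1,\dots,\lambda_n\in\mathbb C$ be its eigenvalues, listed with algebraic multiplicity. Then the maximum defining $\mathcal R_T$ is attained; every maximizing covariance $\Sigma$ is diagonal in the eigenbasis of $A$, that is, $U\Sigma U^\dagger$ is diagonal for every unitary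 $U\in\mathbb C^{n\times n}$ for which $UAU^\dagger$ is diagonal; and $$\mathcal R_T=\max_{\substack{P_1,\dots,P_n\ge 0\\ P_1+\dots+P_n=P}}\ \sum_{i=1}^n\mathcal R_T(P_i,\lambda_i),\qquad \mathcal R_T(P,\lambda)=\frac1{2T}\log_2\frac{\frac{P}{\sigma^2}-2\,\mathrm{Re}\,\lambda}{\frac{P}{\sigma^2}e^{2T\,\mathrm{Re}\,\lambda}-2\,\mathrm{Re}\,\lambda},$$ where the maximum on the right is attained. -/

import Mathlib

noncomputable section

namespace InfoRate

/-- Observability Gramian `∫₀ᵀ e^{Aᵀt} Cᵀ C e^{At} dt` of the pair `(A, C)` over `[0, T]`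
(the integral of the matrix-valued function is taken entry by entry). -/
def obsGramian {n p : ℕ} (A : Matrix (Fin n) (Fin n) ℝ) (C : Matrix (Fin p) (Fin n) ℝ) (T : ℝ) :
    Matrix (Fin n) (Fin n) ℝ :=
  Matrix.of fun i j =>
    ∫ t in (0 : ℝ)..T,
      (NormedSpace.exp (t • A.transpose) * (C.transpose * C) * NormedSpace.exp (t • A)) i j

/-- Infinite-horizon controllability Gramian `∑_{k ≥ 0} e^{AkT} B Σ Bᵀ e^{AᵀkT}` of the
discretized pair `(e^{AT}, B Σ^{1/2})`. -/
def ctrlGramian {n m : ℕ} (A : Matrix (Fin n) (Fin n) ℝ) (B : Matrix (Fin n) (Fin m) ℝ) (T : ℝ)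
    (S : Matrix (Fin m) (Fin m) ℝ) : Matrix (Fin n) (Fin n) ℝ :=
  ∑' k : ℕ, NormedSpace.exp (((k : ℝ) * T) • A) * (B * S * B.transpose) *
    NormedSpace.exp (((k : ℝ) * T) • A.transpose)

/-- The mutual information (in bits) between one input symbol with covariance `Σ` and the
corrupted output over a window of length `T`:
`(1/2) log₂ (det (σ² I + O W) / det (σ² I + O (W - B Σ Bᵀ)))`. -/
def info {n m p : ℕ} (A : Matrix (Fin n) (Fin n) ℝ) (B : Matrix (Fin n) (Fin m) ℝ)
    (C : Matrix (Fin p) (Fin n) ℝ) (T σ : ℝ) (S : Matrix (Fin m) (Fin m) ℝ) : ℝ :=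
  1 / 2 * Real.logb 2
    ((σ ^ 2 • (1 : Matrix (Fin n) (Fin n) ℝ) + obsGramian A C T * ctrlGramian A B T S).det /
      (σ ^ 2 • (1 : Matrix (Fin n) (Fin n) ℝ) +
        obsGramian A C T * (ctrlGramian A B T S - B * S * B.transpose)).det)

/-- Input covariances of power at most `P`. -/
def admissible (m : ℕ) (P : ℝ) : Set (Matrix (Fin m) (Fin m) ℝ) :=
  {S | S.PosSemidef ∧ S.trace ≤ P}

/-- Information capacity `C_T`: the largest value of `info` over the admissible covariances. -/
def capacity {n m p : ℕ} (A : Matrix (Fin n) (Fin n) ℝ) (B : Matrix (Fin n) (Fin m) ℝ)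
    (C : Matrix (Fin p) (Fin n) ℝ) (T σ P : ℝ) : ℝ :=
  sSup (info A B C T σ '' admissible m P)

/-- Information rate `R_T = C_T / T`. -/
def rate {n m p : ℕ} (A : Matrix (Fin n) (Fin n) ℝ) (B : Matrix (Fin n) (Fin m) ℝ)
    (C : Matrix (Fin p) (Fin n) ℝ) (T σ P : ℝ) : ℝ :=
  capacity A B C T σ P / T

/-- A real matrix seen as a complex one. -/
def toComplex {n : ℕ} (A : Matrix (Fin n) (Fin n) ℝ) : Matrix (Fin n) (Fin n) ℂ :=
  A.map (algebraMap ℝ ℂ)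

/-- Hurwitz stability: every complex eigenvalue has negative real part. -/
def IsStable {n : ℕ} (A : Matrix (Fin n) (Fin n) ℝ) : Prop :=
  ∀ μ ∈ spectrum ℂ (toComplex A), μ.re < 0

/-- `l` lists the complex eigenvalues of `A` with algebraic multiplicity. -/
def IsEigenvalueList {n : ℕ} (A : Matrix (Fin n) (Fin n) ℝ) (l : Fin n → ℂ) : Prop :=
  (toComplex A).charpoly = ∏ i, (Polynomial.X - Polynomial.C (l i))

/-- The scalar rate `R_T(P, l)`. -/
def scalarRate (T σ P : ℝ) (l : ℂ) : ℝ :=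
  1 / (2 * T) * Real.logb 2
    ((P / σ ^ 2 - 2 * l.re) / (P / σ ^ 2 * Real.exp (2 * T * l.re) - 2 * l.re))

/-- Allocations of the total power `P` to `n` modes. -/
def allocations (n : ℕ) (P : ℝ) : Set (Fin n → ℝ) :=
  {p | (∀ i, 0 ≤ p i) ∧ ∑ i, p i = P}

end InfoRate

end

namespace InfoRate

open Matrix
open scoped ComplexOrder

/-! ### Determinant growth under diagonal perturbation: a Fischer-type inequality. -/

section Fischer

variable {ι : Type*}

/-! In an orthonormal eigenbasis of `A` the observability Gramian is diagonal with positive entries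
g_i, and the controllability Gramian is the entrywise rescaling W_ij = S_ij / (1 - e^{T d_i}
conj(e^{T d_j})), so that W - S = E W E† with E = diag(e^{T d_i}). Factoring out diag(g_i) and E,
the information becomes -1/2 log₂ of ∏ q_i · det(Y + N) / det Y, where Y = diag(σ²/g_i) + W is
positive definite, q_i = |e^{T d_i}|², and N is a fixed positive diagonal matrix
(`det_noise_add_modalGramian`, `info_eq_modal`).

The heart is `prod_le_det_add_diagonal_div_det`: det(Y + N) / det Y ≥ ∏ (1 + N_i / Y_ii), with
equality only for diagonal Y. Hence off-diagonal correlations only lose information, and a diagonal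
covariance yields exactly the sum of the scalar rates (`info_le_sum_scalarRate`). This bounds the
information by the allocation problem, whose maximum exists by compactness.

Attainment has one catch: a covariance diagonal in a complex eigenbasis need not be real. Strict
concavity of the scalar rate forces an optimal allocation to give equal power to modes with equal
real part (`optimal_allocation_eq_of_re_eq`), in particular to conjugate pairs. Such an allocation
is realized by a real polynomial in `A + Aᵀ` (`exists_admissible_of_allocation`). The bound holds in
every eigenbasis, so a maximizer meets the equality case in each of them. -/

lemma posDef_diag_re_pos {Y : Matrix ι ι ℂ} (hY : Y.PosDef) (i : ι) : 0 < (Y i i).re :=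
  (Complex.pos_iff.mp (hY.diag_pos (i := i))).1

lemma posDef_coe_diag_re {Y : Matrix ι ι ℂ} (hY : Y.PosDef) (i : ι) : ((Y i i).re : ℂ) = Y i i :=
  Complex.ext rfl (Complex.pos_iff.mp (hY.diag_pos (i := i))).2

variable [DecidableEq ι]

lemma posDef_add_diagonal_nonneg {Y : Matrix ι ι ℂ} (hY : Y.PosDef) {N : ι → ℝ}
    (hN : ∀ i, 0 ≤ N i) : (Y + diagonal fun i => (N i : ℂ)).PosDef :=
  hY.add_posSemidef (PosSemidef.diagonal fun i => Complex.zero_le_real.mpr (hN i))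

variable [Fintype ι]

lemma posDef_coe_det_re {Y : Matrix ι ι ℂ} (hY : Y.PosDef) : (Y.det.re : ℂ) = Y.det :=
  Complex.ext rfl (Complex.pos_iff.mp hY.det_pos).2

lemma posDef_det_re_pos {Y : Matrix ι ι ℂ} (hY : Y.PosDef) : 0 < Y.det.re :=
  (Complex.pos_iff.mp hY.det_pos).1

/-- The quadratic form of `Y` at the vector `eᵢ - c Y⁻¹ eᵢ`. -/
lemma posDef_quadratic_form_inverse_column {Y : Matrix ι ι ℂ} (hY : Y.PosDef) (i : ι) (c : ℝ) :
    star (Pi.single i 1 - (c : ℂ) • Y⁻¹.col i) ⬝ᵥ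
        (Y *ᵥ (Pi.single i 1 - (c : ℂ) • Y⁻¹.col i)) =
      (((Y i i).re - 2 * c + c ^ 2 * (Y⁻¹ i i).re : ℝ) : ℂ) := by
  have hdet : IsUnit Y.det := (Matrix.isUnit_iff_isUnit_det _).mp hY.isUnit
  have hcol : Y *ᵥ Y⁻¹.col i = Pi.single i 1 := by
    rw [← Matrix.mulVec_single_one, Matrix.mulVec_mulVec, Matrix.mul_nonsing_inv _ hdet,
      Matrix.one_mulVec]
  have hrow : star (Y⁻¹.col i) = Y⁻¹.row i := by
    ext j
    exact hY.inv.isHermitian.apply i j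
  have hinv : Y⁻¹.row i ⬝ᵥ Y.col i = 1 := by
    have := congrFun (congrFun (Matrix.nonsing_inv_mul _ hdet) i) i
    simpa [Matrix.mul_apply, dotProduct, Matrix.row, Matrix.col] using this
  rw [Matrix.mulVec_sub, Matrix.mulVec_smul, hcol, Matrix.mulVec_single_one, star_sub, star_smul,
    hrow, sub_dotProduct, dotProduct_sub, dotProduct_sub, smul_dotProduct, smul_dotProduct, hinv]
  have h1 := posDef_coe_diag_re hY i
  have h2 := posDef_coe_diag_re hY.inv i
  push_cast
  rw [h1, h2]
  simp [dotProduct_single, Matrix.row, Matrix.col]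
  ring

/-- The choice c = 1 / (Y⁻¹)_ii minimizes the quadratic form at eᵢ - c Y⁻¹ eᵢ; its minimum Y_ii - 1
/ (Y⁻¹)_ii is nonnegative. -/
lemma one_le_diag_mul_inv_diag {Y : Matrix ι ι ℂ} (hY : Y.PosDef) (i : ι) :
    1 ≤ (Y i i).re * (Y⁻¹ i i).re := by
  have h := hY.posSemidef.dotProduct_mulVec_nonneg
    (Pi.single i 1 - (((Y⁻¹ i i).re⁻¹ : ℝ) : ℂ) • Y⁻¹.col i)
  rw [posDef_quadratic_form_inverse_column hY] at h
  have h' := Complex.zero_le_real.mp h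
  have hp := posDef_diag_re_pos hY.inv i
  have : (Y i i).re - 2 * (Y⁻¹ i i).re⁻¹ + (Y⁻¹ i i).re⁻¹ ^ 2 * (Y⁻¹ i i).re =
      ((Y i i).re * (Y⁻¹ i i).re - 1) * (Y⁻¹ i i).re⁻¹ := by
    field_simp
    ring
  rw [this] at h'
  have := nonneg_of_mul_nonneg_left h' (inv_pos.mpr hp)
  linarith

/-- Equality makes the form vanish at eᵢ - c Y⁻¹ eᵢ, so definiteness kills this vector. Applying Y
then shows that Y eᵢ is a multiple of eᵢ. -/
lemma offDiag_eq_zero_of_diag_mul_inv_diag {Y : Matrix ι ι ℂ} (hY : Y.PosDef) (i : ι)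
    (h : (Y i i).re * (Y⁻¹ i i).re = 1) (j : ι) (hj : j ≠ i) : Y j i = 0 := by
  have hp := posDef_diag_re_pos hY.inv i
  set v := Pi.single i 1 - (((Y⁻¹ i i).re⁻¹ : ℝ) : ℂ) • Y⁻¹.col i with hv
  have hq := posDef_quadratic_form_inverse_column hY i (Y⁻¹ i i).re⁻¹
  have hz : (Y i i).re - 2 * (Y⁻¹ i i).re⁻¹ + (Y⁻¹ i i).re⁻¹ ^ 2 * (Y⁻¹ i i).re = 0 := by
    field_simp
    linarith
  rw [hz, ← hv] at hq
  have hv0 : v = 0 := by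
    by_contra hne
    have := hY.dotProduct_mulVec_pos hne
    rw [hq] at this
    simp at this
  have hdet : IsUnit Y.det := (Matrix.isUnit_iff_isUnit_det _).mp hY.isUnit
  have hcol : Y *ᵥ Y⁻¹.col i = Pi.single i 1 := by
    rw [← Matrix.mulVec_single_one, Matrix.mulVec_mulVec, Matrix.mul_nonsing_inv _ hdet,
      Matrix.one_mulVec]
  have h0 : Y *ᵥ v = 0 := by rw [hv0, Matrix.mulVec_zero]
  rw [hv, Matrix.mulVec_sub, Matrix.mulVec_smul, hcol, Matrix.mulVec_single_one] at h0
  have := congrFun h0 j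
  simpa [hj, Matrix.col] using this

/-- The perturbation has rank one, so the matrix determinant lemma applies. -/
lemma det_add_diagonal_single {Y : Matrix ι ι ℂ} (hY : IsUnit Y.det) (i : ι) (c : ℂ) :
    (Y + diagonal (Pi.single i c)).det = Y.det * (1 + c * Y⁻¹ i i) := by
  have h : diagonal (Pi.single i c) =
      replicateCol Unit (Pi.single i c) * replicateRow Unit (Pi.single i (1 : ℂ)) := by
    ext a b
    by_cases ha : a = i <;> by_cases hb : b = i <;>
      simp [Matrix.mul_apply, diagonal_apply, ha, hb, eq_comm (a := i)]
  rw [h, det_add_replicateCol_mul_replicateRow hY]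
  congr 1
  simp [Matrix.mul_apply, Pi.single_apply, mul_comm]

/-- Adding positive entries on the diagonal positions in `s` increases the determinant of a positive
definite matrix at least as much as it would if the matrix were diagonal. -/
lemma prod_le_det_add_diagonal_div_det {Y : Matrix ι ι ℂ} (hY : Y.PosDef) {N : ι → ℝ}
    (hN : ∀ i, 0 < N i) (s : Finset ι) :
    ∏ i ∈ s, (1 + N i / (Y i i).re) ≤
        (Y + diagonal fun i => ((if i ∈ s then N i else 0 : ℝ) : ℂ)).det.re / Y.det.re ∧
      (∏ i ∈ s, (1 + N i / (Y i i).re) =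
          (Y + diagonal fun i => ((if i ∈ s then N i else 0 : ℝ) : ℂ)).det.re / Y.det.re →
        ∀ i ∈ s, ∀ j, j ≠ i → Y j i = 0) := by
  induction s using Finset.induction_on with
  | empty =>
    have h0 : (diagonal fun _ : ι => (0 : ℂ)) = 0 := diagonal_zero
    simp [h0, (posDef_det_re_pos hY).ne']
  | insert i s hi ih =>
    -- Z carries the increments already made. Since i ∉ s, its i-th diagonal entry is still that of
    -- Y, so the new factor 1 + N_i (Z⁻¹)_ii is at least 1 + N_i / Y_ii.
    set Z := Y + diagonal fun i => ((if i ∈ s then N i else 0 : ℝ) : ℂ) with hZ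
    have hZp : Z.PosDef := posDef_add_diagonal_nonneg hY fun i => by
      split_ifs
      exacts [(hN i).le, le_rfl]
    have hins : (Y + diagonal fun j => ((if j ∈ insert i s then N j else 0 : ℝ) : ℂ)) =
        Z + diagonal (Pi.single i (N i : ℂ)) := by
      rw [hZ, add_assoc, diagonal_add]
      congr 2
      ext j
      by_cases hj : j = i
      · subst hj; simp [hi]
      · simp [hj]
    have hdet : (Z + diagonal (Pi.single i (N i : ℂ))).det.re =
        Z.det.re * (1 + N i * (Z⁻¹ i i).re) := by
      rw [det_add_diagonal_single ((Matrix.isUnit_iff_isUnit_det _).mp hZp.isUnit),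
        ← posDef_coe_det_re hZp, ← posDef_coe_diag_re hZp.inv i]
      norm_cast
    have hZii : Z i i = Y i i := by simp [hZ, hi]
    have hle := one_le_diag_mul_inv_diag hZp i
    have hYi := posDef_diag_re_pos hY i
    rw [hZii] at hle
    have hle' : 1 / (Y i i).re ≤ (Z⁻¹ i i).re := by
      rw [div_le_iff₀ hYi, mul_comm]; exact hle
    have hstep : 1 + N i / (Y i i).re ≤ 1 + N i * (Z⁻¹ i i).re := by
      have := mul_le_mul_of_nonneg_left hle' (hN i).le
      rw [mul_one_div] at this
      linarith
    have hpos : 0 < 1 + N i / (Y i i).re := by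
      have := div_pos (hN i) hYi
      linarith
    have hratio : 0 < Z.det.re / Y.det.re :=
      div_pos (posDef_det_re_pos hZp) (posDef_det_re_pos hY)
    rw [Finset.prod_insert hi, hins, hdet,
      show Z.det.re * (1 + N i * (Z⁻¹ i i).re) / Y.det.re =
        (1 + N i * (Z⁻¹ i i).re) * (Z.det.re / Y.det.re) by ring]
    have hprod : 0 < ∏ j ∈ s, (1 + N j / (Y j j).re) := Finset.prod_pos fun j _ => by
      have := div_pos (hN j) (posDef_diag_re_pos hY j)
      linarith
    refine ⟨mul_le_mul hstep ih.1 hprod.le (hpos.le.trans hstep), fun heq => ?_⟩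
    -- Equality of products of positive factors, each dominated by its counterpart, forces equality
    -- factor by factor.
    have h1 : ∏ j ∈ s, (1 + N j / (Y j j).re) = Z.det.re / Y.det.re := by
      refine le_antisymm ih.1 (le_of_not_gt fun hlt => ?_)
      have := mul_lt_mul' hstep hlt hprod.le (hpos.trans_le hstep)
      exact absurd heq this.ne
    rw [h1] at heq
    have h2 := mul_right_cancel₀ hratio.ne' heq
    have h3 : (Z i i).re * (Z⁻¹ i i).re = 1 := by
      have h4 : N i / (Y i i).re = N i * (Z⁻¹ i i).re := by linarith
      rw [div_eq_mul_inv] at h4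
      rw [hZii, ← mul_left_cancel₀ (hN i).ne' h4, mul_inv_cancel₀ hYi.ne']
    intro k hk j hjk
    rcases Finset.mem_insert.mp hk with rfl | hk
    · have := offDiag_eq_zero_of_diag_mul_inv_diag hZp k h3 j hjk
      simpa [hZ, hjk] using this
    · exact ih.2 h1 k hk j hjk

end Fischer

end InfoRate

/-! ### Unitary diagonalization of normal matrices. -/

namespace InfoRate

open Matrix

/-- Commuting symmetric operators have an orthonormal basis of common eigenvectors. -/
lemma exists_orthonormalBasis_of_commute {E : Type*} [NormedAddCommGroup E] [InnerProductSpace ℂ E]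
    [FiniteDimensional ℂ E] {n : ℕ} (hn : Module.finrank ℂ E = n) {F G : E →ₗ[ℂ] E}
    (hF : F.IsSymmetric) (hG : G.IsSymmetric) (hFG : Commute F G) :
    ∃ (b : OrthonormalBasis (Fin n) ℂ E) (h k : Fin n → ℂ),
      (∀ a, F (b a) = h a • b a) ∧ ∀ a, G (b a) = k a • b a := by
  classical
  have hdecomp := LinearMap.IsSymmetric.directSum_isInternal_of_commute hF hG hFG
  have horth := LinearMap.IsSymmetric.orthogonalFamily_eigenspace_inf_eigenspace hF hG
  -- The joint eigenspaces are indexed by all of ℂ × ℂ; an orthonormal basis can be assembled once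
  -- the index set is cut down to the finitely many nonzero ones.
  have hfin := WellFoundedGT.finite_ne_bot_of_iSupIndep hdecomp.submodule_iSupIndep
  have hdecomp' := DirectSum.isInternal_ne_bot_iff.mpr hdecomp
  have horth' := horth.comp (Subtype.val_injective (p := fun i : ℂ × ℂ =>
    Module.End.eigenspace F i.2 ⊓ Module.End.eigenspace G i.1 ≠ ⊥))
  let _ : Fintype {i : ℂ × ℂ // Module.End.eigenspace F i.2 ⊓ Module.End.eigenspace G i.1 ≠ ⊥} :=
    hfin.fintype
  have hb := fun a => hdecomp'.subordinateOrthonormalBasis_subordinate hn a horth'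
  exact ⟨hdecomp'.subordinateOrthonormalBasis hn horth',
    fun a => (hdecomp'.subordinateOrthonormalBasisIndex hn a horth').1.2,
    fun a => (hdecomp'.subordinateOrthonormalBasisIndex hn a horth').1.1,
    fun a => Module.End.mem_eigenspace_iff.mp (hb a).1,
    fun a => Module.End.mem_eigenspace_iff.mp (hb a).2⟩

/-- Commuting Hermitian matrices are simultaneously unitarily diagonalizable. -/
lemma exists_unitary_diagonalization_of_commute {n : ℕ} {H K : Matrix (Fin n) (Fin n) ℂ}
    (hH : H.IsHermitian) (hK : K.IsHermitian) (hHK : Commute H K) :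
    ∃ U ∈ Matrix.unitaryGroup (Fin n) ℂ, ∃ h k : Fin n → ℂ,
      H = Uᴴ * diagonal h * U ∧ K = Uᴴ * diagonal k * U := by
  have hcomm : Commute (Matrix.toEuclideanLin H) (Matrix.toEuclideanLin K) := by
    ext x : 1
    have := congrArg (fun M : Matrix (Fin n) (Fin n) ℂ => WithLp.toLp 2 (M *ᵥ x.ofLp)) hHK.eq
    simpa [Matrix.mulVec_mulVec, Matrix.toLpLin_apply] using this
  obtain ⟨b, h, k, hbH, hbK⟩ := exists_orthonormalBasis_of_commute
    (finrank_euclideanSpace_fin (𝕜 := ℂ) (n := n))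
    (Matrix.isSymmetric_toEuclideanLin_iff.mpr hH) (Matrix.isSymmetric_toEuclideanLin_iff.mpr hK)
    hcomm
  set V := (EuclideanSpace.basisFun (Fin n) ℂ).toBasis.toMatrix b with hV
  have hVapp : ∀ i a, V i a = b a i := fun i a => by
    simp [hV, Module.Basis.toMatrix_apply]
  have hVmem : V ∈ Matrix.unitaryGroup (Fin n) ℂ :=
    (EuclideanSpace.basisFun (Fin n) ℂ).toMatrix_orthonormalBasis_mem_unitary b
  have hVV : V * Vᴴ = 1 := Matrix.mem_unitaryGroup_iff.mp hVmem
  have key : ∀ (M : Matrix (Fin n) (Fin n) ℂ) (m : Fin n → ℂ),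
      (∀ a, Matrix.toEuclideanLin M (b a) = m a • b a) → M = V * diagonal m * Vᴴ := by
    intro M m h
    have hMV : M * V = V * diagonal m := by
      ext i a
      have := congrArg (fun x => x.ofLp i) (h a)
      simp only [Matrix.toLpLin_apply] at this
      rw [Matrix.mul_diagonal, hVapp, mul_comm]
      simpa [Matrix.mul_apply, hVapp, Matrix.mulVec, dotProduct] using this
    rw [← hMV, Matrix.mul_assoc, hVV, Matrix.mul_one]
  refine ⟨Vᴴ, Unitary.star_mem hVmem, h, k, ?_, ?_⟩
  · rw [conjTranspose_conjTranspose]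
    exact key _ _ hbH
  · rw [conjTranspose_conjTranspose]
    exact key _ _ hbK

/-- Normal complex matrices are unitarily diagonalizable. -/
lemma exists_unitary_diagonalization_of_normal {n : ℕ} {M : Matrix (Fin n) (Fin n) ℂ}
    (hM : M * Mᴴ = Mᴴ * M) :
    ∃ U ∈ Matrix.unitaryGroup (Fin n) ℂ, ∃ d : Fin n → ℂ, M = Uᴴ * diagonal d * U := by
  have hH : (M + Mᴴ).IsHermitian := by
    rw [IsHermitian, conjTranspose_add, conjTranspose_conjTranspose, add_comm]
  have hK : (Complex.I • (Mᴴ - M)).IsHermitian := by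
    rw [IsHermitian, conjTranspose_smul, conjTranspose_sub, conjTranspose_conjTranspose]
    simp [smul_sub, neg_add_eq_sub]
  have hcomm : Commute (M + Mᴴ) (Complex.I • (Mᴴ - M)) := by
    refine Commute.smul_right ?_ _
    rw [commute_iff_eq]
    simp only [mul_sub, add_mul, sub_mul, mul_add, hM]
    abel
  obtain ⟨U, hU, h, k, h1, h2⟩ := exists_unitary_diagonalization_of_commute hH hK hcomm
  -- With H = M + M† and K = i(M† - M), one has M = (H + iK) / 2; normality is what makes H and K
  -- commute.
  refine ⟨U, hU, fun i => (h i + Complex.I * k i) / 2, ?_⟩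
  have h3 : M = (1 / 2 : ℂ) • ((M + Mᴴ) + Complex.I • (Complex.I • (Mᴴ - M))) := by
    rw [smul_smul, Complex.I_mul_I, neg_one_smul, neg_sub,
      show M + Mᴴ + (M - Mᴴ) = (2 : ℂ) • M by rw [two_smul]; abel, smul_smul]
    norm_num
  have h4 : (diagonal fun i => (h i + Complex.I * k i) / 2) =
      (1 / 2 : ℂ) • (diagonal h + Complex.I • diagonal k) := by
    rw [← diagonal_smul, diagonal_add, ← diagonal_smul]
    congr 1
    ext i
    simp
    ring
  conv_lhs => rw [h3, h1, h2]
  rw [h4]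
  simp only [Matrix.mul_smul, Matrix.smul_mul, Matrix.mul_add, Matrix.add_mul]

end InfoRate

/-! ### Monotonicity and strict midpoint concavity of the scalar rate. -/

namespace InfoRate

lemma ratio_pos {b q x : ℝ} (hb : 0 < b) (hq : 0 < q) (hx : 0 ≤ x) :
    0 < (x + b) / (x * q + b) := by positivity

lemma ratio_mono {b q x y : ℝ} (hb : 0 < b) (hq : 0 < q) (hq1 : q < 1) (hx : 0 ≤ x)
    (hxy : x ≤ y) : (x + b) / (x * q + b) ≤ (y + b) / (y * q + b) := by
  have hy := hx.trans hxy
  rw [div_le_div_iff₀ (by positivity) (by positivity)]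
  nlinarith [mul_nonneg (mul_nonneg hb.le (sub_nonneg.mpr hq1.le)) (sub_nonneg.mpr hxy)]

/-- This is strict midpoint concavity of the logarithm of the ratio. With m the midpoint and d half
the difference, cross-multiplying leaves d² ((mq + b)² - q² (m + b)²) = d² b (1 - q) (2qm + b (1 +
q)), which is positive. -/
lemma ratio_mul_lt_midpoint_sq {b q x y : ℝ} (hb : 0 < b) (hq : 0 < q) (hq1 : q < 1)
    (hx : 0 ≤ x) (hy : 0 ≤ y) (hxy : x ≠ y) :
    (x + b) / (x * q + b) * ((y + b) / (y * q + b)) <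
      ((x + y) / 2 + b) / ((x + y) / 2 * q + b) * (((x + y) / 2 + b) / ((x + y) / 2 * q + b)) := by
  rw [div_mul_div_comm, div_mul_div_comm, div_lt_div_iff₀ (by positivity) (by positivity)]
  obtain ⟨m, hm⟩ : ∃ m, m = (x + y) / 2 := ⟨_, rfl⟩
  obtain ⟨d, hd⟩ : ∃ d, d = (x - y) / 2 := ⟨_, rfl⟩
  have hd0 : 0 < d ^ 2 := by
    have : d ≠ 0 := fun h => hxy (by linarith)
    positivity
  have hm0 : 0 ≤ m := by linarith
  rw [← hm, show x = m + d by linarith, show y = m - d by linarith]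
  have h1 : 0 < d ^ 2 * (b * (1 - q)) * (2 * q * m + b * (1 + q)) := by
    have := sub_pos.mpr hq1
    positivity
  nlinarith [h1]

lemma scalarRate_eq {T σ p : ℝ} (l : ℂ) :
    scalarRate T σ p l = 1 / (2 * T) * Real.logb 2
      ((p / σ ^ 2 + -2 * l.re) / (p / σ ^ 2 * Real.exp (2 * T * l.re) + -2 * l.re)) := by
  unfold scalarRate
  ring_nf

section Scalar

variable {T σ : ℝ} {l : ℂ}

lemma exp_re_lt_one (hT : 0 < T) (hl : l.re < 0) : Real.exp (2 * T * l.re) < 1 :=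
  Real.exp_lt_one_iff.mpr (by nlinarith)

lemma scalarRate_mono (hT : 0 < T) (hσ : 0 < σ) (hl : l.re < 0) {x y : ℝ} (hx : 0 ≤ x)
    (hxy : x ≤ y) : scalarRate T σ x l ≤ scalarRate T σ y l := by
  rw [scalarRate_eq, scalarRate_eq]
  refine mul_le_mul_of_nonneg_left ?_ (by positivity)
  have hb : 0 < -2 * l.re := by linarith
  exact Real.logb_le_logb_of_le one_lt_two
    (ratio_pos hb (Real.exp_pos _) (by positivity))
    (ratio_mono hb (Real.exp_pos _) (exp_re_lt_one hT hl) (by positivity) (by gcongr))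

lemma scalarRate_add_lt_midpoint (hT : 0 < T) (hσ : 0 < σ) (hl : l.re < 0) {x y : ℝ} (hx : 0 ≤ x)
    (hy : 0 ≤ y) (hxy : x ≠ y) :
    scalarRate T σ x l + scalarRate T σ y l < 2 * scalarRate T σ ((x + y) / 2) l := by
  have hb : 0 < -2 * l.re := by linarith
  have hq := Real.exp_pos (2 * T * l.re)
  have hσ2 : 0 < σ ^ 2 := by positivity
  have h := ratio_mul_lt_midpoint_sq hb hq (exp_re_lt_one hT hl)
    (div_nonneg hx hσ2.le) (div_nonneg hy hσ2.le) (fun h => hxy ((div_left_inj' hσ2.ne').mp h))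
  rw [show (x / σ ^ 2 + y / σ ^ 2) / 2 = (x + y) / 2 / σ ^ 2 by ring] at h
  have hx' := ratio_pos hb hq (div_nonneg hx hσ2.le)
  have hy' := ratio_pos hb hq (div_nonneg hy hσ2.le)
  have hm' := ratio_pos hb hq (div_nonneg (show 0 ≤ (x + y) / 2 by positivity) hσ2.le)
  have h' := Real.logb_lt_logb one_lt_two (mul_pos hx' hy') h
  rw [Real.logb_mul hx'.ne' hy'.ne', Real.logb_mul hm'.ne' hm'.ne'] at h'
  rw [scalarRate_eq, scalarRate_eq, scalarRate_eq]
  have hT' : 0 < 1 / (2 * T) := by positivity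
  nlinarith [mul_lt_mul_of_pos_left h' hT']

lemma continuousOn_scalarRate (hσ : 0 < σ) (hl : l.re < 0) :
    ContinuousOn (fun x => scalarRate T σ x l) (Set.Ici 0) := by
  simp_rw [scalarRate_eq]
  have hb : 0 < -2 * l.re := by linarith
  have hσ2 : 0 < σ ^ 2 := by positivity
  have hq := Real.exp_pos (2 * T * l.re)
  refine continuousOn_const.mul (ContinuousOn.div_const (ContinuousOn.log ?_ ?_) _)
  · refine ContinuousOn.div (by fun_prop) (by fun_prop) fun x hx => ?_
    have : 0 ≤ x / σ ^ 2 := div_nonneg hx hσ2.le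
    positivity
  · exact fun x hx => (ratio_pos hb hq (div_nonneg hx hσ2.le)).ne'

end Scalar

/-! ### Optimal power allocations. -/

section Allocation

variable {n : ℕ} {P T σ : ℝ}

lemma isCompact_allocations : IsCompact (allocations n P) := by
  have hsub : allocations n P ⊆ Set.pi Set.univ fun _ => Set.Icc 0 P := by
    rintro p ⟨h0, hs⟩ i _
    exact ⟨h0 i, hs ▸ Finset.single_le_sum (fun j _ => h0 j) (Finset.mem_univ i)⟩
  refine (isCompact_univ_pi fun _ => isCompact_Icc).of_isClosed_subset ?_ hsub
  refine IsClosed.inter (s₁ := {p : Fin n → ℝ | ∀ i, 0 ≤ p i}) (s₂ := {p | ∑ i, p i = P}) ?_ ?_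
  · rw [Set.ofPred_forall]
    exact isClosed_iInter fun i => isClosed_le continuous_const (continuous_apply i)
  · exact isClosed_eq (continuous_finsetSum _ fun i _ => continuous_apply i) continuous_const

lemma exists_optimal_allocation (hn : 0 < n) (hσ : 0 < σ) (hP : 0 ≤ P) {l : Fin n → ℂ}
    (hl : ∀ i, (l i).re < 0) :
    ∃ p ∈ allocations n P, ∀ p' ∈ allocations n P,
      ∑ i, scalarRate T σ (p' i) (l i) ≤ ∑ i, scalarRate T σ (p i) (l i) := by
  have hne : (allocations n P).Nonempty :=
    ⟨Pi.single ⟨0, hn⟩ P, fun i => by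
      by_cases h : i = ⟨0, hn⟩
      · subst h; simpa using hP
      · simp [h], by simp⟩
  obtain ⟨p, hp, hmax⟩ := isCompact_allocations.exists_isMaxOn hne
    (f := fun p : Fin n → ℝ => ∑ i, scalarRate T σ (p i) (l i))
    (continuousOn_finsetSum _ fun i _ =>
      (continuousOn_scalarRate hσ (hl i)).comp (continuous_apply i).continuousOn
        fun p hp => hp.1 i)
  exact ⟨p, hp, fun _ hmem => hmax hmem⟩

/-- An optimal allocation gives the same power to modes with the same decay rate. -/
lemma optimal_allocation_eq_of_re_eq (hT : 0 < T) (hσ : 0 < σ) {l : Fin n → ℂ}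
    (hl : ∀ i, (l i).re < 0) {p : Fin n → ℝ} (hp : p ∈ allocations n P)
    (hmax : ∀ p' ∈ allocations n P,
      ∑ i, scalarRate T σ (p' i) (l i) ≤ ∑ i, scalarRate T σ (p i) (l i))
    {i j : Fin n} (hij : (l i).re = (l j).re) : p i = p j := by
  by_contra hne
  have hij' : i ≠ j := fun h => hne (h ▸ rfl)
  set m := (p i + p j) / 2 with hm
  -- Averaging the two powers keeps the total. As the scalar rate sees only the real part of the
  -- eigenvalue, strict concavity would make the sum strictly larger.
  set p' : Fin n → ℝ := Function.update (Function.update p i m) j m with hp'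
  have hi' : p' i = m := by simp [hp', hij']
  have hj' : p' j = m := by simp [hp']
  have hk' : ∀ k, k ≠ i ∧ k ≠ j → p' k = p k := fun k hk => by simp [hp', hk.1, hk.2]
  have hsplit : ∀ f : Fin n → ℝ, ∑ k, f k =
      f i + f j + ∑ k ∈ (Finset.univ.erase i).erase j, f k := fun f => by
    rw [add_assoc, Finset.add_sum_erase _ f (by simp [hij'.symm]),
      Finset.add_sum_erase _ f (Finset.mem_univ i)]
  have hrest : ∀ k ∈ (Finset.univ.erase i).erase j, p' k = p k := fun k hk => by
    simp only [Finset.mem_erase, Finset.mem_univ, and_true] at hk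
    exact hk' k ⟨hk.2, hk.1⟩
  have hmem : p' ∈ allocations n P := by
    refine ⟨fun k => ?_, ?_⟩
    · have hm0 : 0 ≤ m := by have := hp.1 i; have := hp.1 j; positivity
      by_cases h1 : k = i
      · rw [h1, hi']; exact hm0
      · by_cases h2 : k = j
        · rw [h2, hj']; exact hm0
        · rw [hk' k ⟨h1, h2⟩]; exact hp.1 k
    · rw [← hp.2, hsplit, hsplit p, hi', hj', Finset.sum_congr rfl hrest, hm]
      ring
  have h := hmax p' hmem
  rw [hsplit, hsplit (fun k => scalarRate T σ (p k) (l k)), hi', hj',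
    Finset.sum_congr rfl fun k hk => by rw [hrest k hk]] at h
  have hlt := scalarRate_add_lt_midpoint hT hσ (hl i) (hp.1 i) (hp.1 j) hne
  have hl' : ∀ x, scalarRate T σ x (l j) = scalarRate T σ x (l i) := fun x => by
    simp only [scalarRate, hij]
  rw [hl', hl'] at h
  linarith

/-- Unused power can be given to any single mode, because each scalar rate is nondecreasing in its
power. -/
lemma exists_allocation_ge (hn : 0 < n) (hT : 0 < T) (hσ : 0 < σ) {l : Fin n → ℂ}
    (hl : ∀ i, (l i).re < 0) {s : Fin n → ℝ} (hs : ∀ i, 0 ≤ s i) (hsP : ∑ i, s i ≤ P) :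
    ∃ p ∈ allocations n P,
      ∑ i, scalarRate T σ (s i) (l i) ≤ ∑ i, scalarRate T σ (p i) (l i) := by
  set e : Fin n → ℝ := Pi.single ⟨0, hn⟩ (P - ∑ i, s i) with he
  have he0 : ∀ i, 0 ≤ e i := fun i => by
    by_cases h : i = ⟨0, hn⟩
    · rw [he, h, Pi.single_eq_same]; linarith
    · simp [he, h]
  refine ⟨fun i => s i + e i, ⟨fun i => add_nonneg (hs i) (he0 i), ?_⟩, ?_⟩
  · rw [Finset.sum_add_distrib, he, Finset.sum_pi_single']
    simp
  · exact Finset.sum_le_sum fun i _ =>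
      scalarRate_mono hT hσ (hl i) (hs i) (le_add_of_nonneg_right (he0 i))

end Allocation

end InfoRate

namespace InfoRate

open Matrix
open scoped ComplexOrder

/-! ### Passage from real to complex matrices. -/

section Complexification

variable {n : ℕ}

lemma toComplex_apply (A : Matrix (Fin n) (Fin n) ℝ) (i j : Fin n) :
    toComplex A i j = (A i j : ℂ) := rfl

lemma toComplex_mul (A B : Matrix (Fin n) (Fin n) ℝ) :
    toComplex (A * B) = toComplex A * toComplex B :=
  (algebraMap ℝ ℂ).mapMatrix.map_mul A B

lemma toComplex_add (A B : Matrix (Fin n) (Fin n) ℝ) :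
    toComplex (A + B) = toComplex A + toComplex B :=
  (algebraMap ℝ ℂ).mapMatrix.map_add A B

lemma toComplex_sub (A B : Matrix (Fin n) (Fin n) ℝ) :
    toComplex (A - B) = toComplex A - toComplex B :=
  (algebraMap ℝ ℂ).mapMatrix.map_sub A B

lemma toComplex_one : toComplex (1 : Matrix (Fin n) (Fin n) ℝ) = 1 :=
  (algebraMap ℝ ℂ).mapMatrix.map_one

lemma toComplex_smul (c : ℝ) (A : Matrix (Fin n) (Fin n) ℝ) :
    toComplex (c • A) = (c : ℂ) • toComplex A := by
  ext i j
  simp [toComplex]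

lemma toComplex_transpose (A : Matrix (Fin n) (Fin n) ℝ) :
    toComplex A.transpose = (toComplex A)ᴴ := by
  ext i j
  simp [toComplex]

lemma toComplex_det (A : Matrix (Fin n) (Fin n) ℝ) : (toComplex A).det = (A.det : ℂ) :=
  ((algebraMap ℝ ℂ).map_det A).symm

lemma toComplex_trace (A : Matrix (Fin n) (Fin n) ℝ) : (toComplex A).trace = (A.trace : ℂ) := by
  simp [toComplex, Matrix.trace]

lemma continuous_toComplex : Continuous (toComplex : Matrix (Fin n) (Fin n) ℝ → _) :=
  continuous_id.matrix_map Complex.continuous_ofReal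

lemma toComplex_exp (A : Matrix (Fin n) (Fin n) ℝ) :
    toComplex (NormedSpace.exp A) = NormedSpace.exp (toComplex A) :=
  open scoped Matrix.Norms.Operator in
  NormedSpace.map_exp (algebraMap ℝ ℂ).mapMatrix continuous_toComplex A

open scoped MatrixOrder Matrix.Norms.L2Operator in
lemma exists_eq_conjTranspose_mul_self {S : Matrix (Fin n) (Fin n) ℝ} (h : S.PosSemidef) :
    ∃ B : Matrix (Fin n) (Fin n) ℝ, S = Bᴴ * B :=
  CStarAlgebra.nonneg_iff_eq_star_mul_self.mp h.nonneg

lemma posSemidef_toComplex_iff {S : Matrix (Fin n) (Fin n) ℝ} :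
    (toComplex S).PosSemidef ↔ S.PosSemidef := by
  constructor
  · intro h
    refine PosSemidef.of_dotProduct_mulVec_nonneg ?_ fun x => ?_
    · ext i j
      have := h.isHermitian.apply i j
      simpa [toComplex] using this
    · have := h.dotProduct_mulVec_nonneg fun i => (x i : ℂ)
      have hcast : star (fun i => (x i : ℂ)) ⬝ᵥ (toComplex S *ᵥ fun i => (x i : ℂ)) =
          ((star x ⬝ᵥ (S *ᵥ x) : ℝ) : ℂ) := by
        simp [dotProduct, mulVec, toComplex]
      rw [hcast] at this
      exact Complex.zero_le_real.mp this
  · intro h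
    -- A real factorization S = Bᵀ B survives complexification, which avoids splitting complex
    -- vectors into real and imaginary parts.
    obtain ⟨B, hB⟩ := exists_eq_conjTranspose_mul_self h
    rw [hB, conjTranspose_eq_transpose_of_trivial, toComplex_mul, toComplex_transpose]
    exact posSemidef_conjTranspose_mul_self _

end Complexification

/-! ### The two Gramians in an orthonormal eigenbasis. -/

section Unitary

variable {n : ℕ} {U : Matrix (Fin n) (Fin n) ℂ}

lemma unitary_mul_conjTranspose (hU : U ∈ Matrix.unitaryGroup (Fin n) ℂ) : U * Uᴴ = 1 :=
  Matrix.mem_unitaryGroup_iff.mp hU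

lemma unitary_conjTranspose_mul (hU : U ∈ Matrix.unitaryGroup (Fin n) ℂ) : Uᴴ * U = 1 :=
  Matrix.mem_unitaryGroup_iff'.mp hU

lemma eq_conj_iff (hU : U ∈ Matrix.unitaryGroup (Fin n) ℂ) {M N : Matrix (Fin n) (Fin n) ℂ} :
    M = Uᴴ * N * U ↔ U * M * Uᴴ = N := by
  have h1 := unitary_mul_conjTranspose hU
  have h2 := unitary_conjTranspose_mul hU
  constructor
  · rintro rfl
    calc U * (Uᴴ * N * U) * Uᴴ = (U * Uᴴ) * N * (U * Uᴴ) := by simp only [Matrix.mul_assoc]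
      _ = N := by rw [h1, Matrix.one_mul, Matrix.mul_one]
  · rintro rfl
    calc M = (Uᴴ * U) * M * (Uᴴ * U) := by rw [h2, Matrix.one_mul, Matrix.mul_one]
      _ = Uᴴ * (U * M * Uᴴ) * U := by simp only [Matrix.mul_assoc]

lemma conj_mul_conj (hU : U ∈ Matrix.unitaryGroup (Fin n) ℂ) (M N : Matrix (Fin n) (Fin n) ℂ) :
    (Uᴴ * M * U) * (Uᴴ * N * U) = Uᴴ * (M * N) * U := by
  calc (Uᴴ * M * U) * (Uᴴ * N * U) = Uᴴ * M * (U * Uᴴ) * N * U := by simp only [Matrix.mul_assoc]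
    _ = Uᴴ * (M * N) * U := by
      rw [unitary_mul_conjTranspose hU, Matrix.mul_one]; simp only [Matrix.mul_assoc]

lemma det_conj (hU : U ∈ Matrix.unitaryGroup (Fin n) ℂ) (M : Matrix (Fin n) (Fin n) ℂ) :
    (Uᴴ * M * U).det = M.det := by
  rw [Matrix.det_mul_right_comm, unitary_conjTranspose_mul hU, Matrix.one_mul]

lemma trace_conj (hU : U ∈ Matrix.unitaryGroup (Fin n) ℂ) (M : Matrix (Fin n) (Fin n) ℂ) :
    (Uᴴ * M * U).trace = M.trace := by
  rw [Matrix.trace_mul_cycle, unitary_mul_conjTranspose hU, Matrix.one_mul]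

lemma exp_conj_diagonal (hU : U ∈ Matrix.unitaryGroup (Fin n) ℂ) (v : Fin n → ℂ) :
    NormedSpace.exp (Uᴴ * diagonal v * U) = Uᴴ * diagonal (fun i => Complex.exp (v i)) * U := by
  have hinv : U⁻¹ = Uᴴ := Matrix.inv_eq_left_inv (unitary_conjTranspose_mul hU)
  have hunit : IsUnit U := IsUnit.of_mul_eq_one _ (unitary_mul_conjTranspose hU)
  rw [← hinv, Matrix.exp_conj' _ _ hunit, Matrix.exp_diagonal]
  congr 3
  ext i
  rw [Complex.exp_eq_exp_ℂ, Pi.coe_exp]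

variable {A : Matrix (Fin n) (Fin n) ℝ} {d : Fin n → ℂ}

lemma toComplex_exp_smul (hU : U ∈ Matrix.unitaryGroup (Fin n) ℂ)
    (hA : toComplex A = Uᴴ * diagonal d * U) (t : ℝ) :
    toComplex (NormedSpace.exp (t • A)) =
      Uᴴ * diagonal (fun i => Complex.exp (t * d i)) * U := by
  rw [toComplex_exp, toComplex_smul, hA, ← exp_conj_diagonal hU]
  congr 1
  rw [← Matrix.smul_mul, ← Matrix.mul_smul, ← diagonal_smul]
  rfl

lemma toComplex_transpose_conj (hA : toComplex A = Uᴴ * diagonal d * U) :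
    toComplex A.transpose = Uᴴ * diagonal (fun i => star (d i)) * U := by
  rw [toComplex_transpose, hA]
  simp only [conjTranspose_mul, conjTranspose_conjTranspose, diagonal_conjTranspose,
    Matrix.mul_assoc]
  rfl

/-- The observability Gramian of a normal matrix in an orthonormal eigenbasis. -/
lemma toComplex_obsGramian (hU : U ∈ Matrix.unitaryGroup (Fin n) ℂ)
    (hA : toComplex A = Uᴴ * diagonal d * U) (hd : ∀ i, (d i).re < 0) (T : ℝ) :
    toComplex (obsGramian A (1 : Matrix (Fin n) (Fin n) ℝ) T) =
      Uᴴ * diagonal (fun i =>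
        (((1 - Real.exp (2 * T * (d i).re)) / (-2 * (d i).re) : ℝ) : ℂ)) * U := by
  have hentry : ∀ (w : Fin n → ℂ) (i j : Fin n), (Uᴴ * diagonal w * U) i j =
      ∑ k, w k * (star (U k i) * U k j) := fun w i j => by
    simp only [Matrix.mul_apply (M := Uᴴ * diagonal w), Matrix.mul_diagonal, conjTranspose_apply]
    exact Finset.sum_congr rfl fun k _ => by ring
  have hintegral : ∀ k, ∫ t in (0 : ℝ)..T, ((Real.exp (2 * (d k).re * t) : ℝ) : ℂ) =
      (((1 - Real.exp (2 * T * (d k).re)) / (-2 * (d k).re) : ℝ) : ℂ) := fun k => by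
    have hk : 2 * (d k).re ≠ 0 := by have := hd k; linarith
    rw [intervalIntegral.integral_ofReal, intervalIntegral.integral_comp_mul_left Real.exp hk,
      integral_exp]
    congr 1
    rw [mul_zero, Real.exp_zero, smul_eq_mul, show 2 * (d k).re * T = 2 * T * (d k).re by ring]
    have := hd k
    field_simp
    ring
  ext i j
  rw [toComplex_apply, hentry]
  simp only [obsGramian, Matrix.of_apply]
  rw [← intervalIntegral.integral_ofReal]
  have hfun : ∀ t : ℝ, (((NormedSpace.exp (t • A.transpose) *
      ((1 : Matrix (Fin n) (Fin n) ℝ).transpose * 1) * NormedSpace.exp (t • A) :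
        Matrix (Fin n) (Fin n) ℝ) i j : ℝ) : ℂ) =
      ∑ k, ((Real.exp (2 * (d k).re * t) : ℝ) : ℂ) * (star (U k i) * U k j) := fun t => by
    rw [← toComplex_apply, transpose_one, Matrix.one_mul, Matrix.mul_one, toComplex_mul,
      toComplex_exp_smul hU hA, toComplex_exp_smul hU (toComplex_transpose_conj hA),
      conj_mul_conj hU, diagonal_mul_diagonal, hentry]
    refine Finset.sum_congr rfl fun k _ => ?_
    rw [← Complex.exp_add, Complex.ofReal_exp, ← mul_add, add_comm (star (d k))]
    congr 2
    have := Complex.add_conj (d k)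
    rw [Complex.star_def, this]
    push_cast
    ring
  simp_rw [hfun]
  rw [intervalIntegral.integral_finsetSum]
  · refine Finset.sum_congr rfl fun k _ => ?_
    rw [intervalIntegral.integral_mul_const, hintegral]
  · intro k _
    exact Continuous.intervalIntegrable (by fun_prop) _ _

/-- Conjugate transposition and each quadratic form are continuous and additive, so they pass
through the sum. -/
lemma posSemidef_of_hasSum {f : ℕ → Matrix (Fin n) (Fin n) ℂ} {W : Matrix (Fin n) (Fin n) ℂ}
    (hf : ∀ k, (f k).PosSemidef) (h : HasSum f W) : W.PosSemidef := by
  refine PosSemidef.of_dotProduct_mulVec_nonneg ?_ fun x => ?_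
  · refine HasSum.unique (f := f) ?_ h
    have := h.matrix_conjTranspose
    simpa only [fun k => (hf k).isHermitian.eq] using this
  · let φ : Matrix (Fin n) (Fin n) ℂ →+ ℂ :=
      { toFun := fun M => star x ⬝ᵥ (M *ᵥ x)
        map_zero' := by simp
        map_add' := fun M N => by rw [add_mulVec, dotProduct_add] }
    have hφ : Continuous φ :=
      continuous_const.dotProduct (continuous_id.matrix_mulVec continuous_const)
    exact (h.map φ hφ).nonneg fun k => (hf k).dotProduct_mulVec_nonneg x

/-- The controllability Gramian of a normal matrix in an orthonormal eigenbasis. -/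
noncomputable def modalGramian (d : Fin n → ℂ) (T : ℝ) (S : Matrix (Fin n) (Fin n) ℂ) :
    Matrix (Fin n) (Fin n) ℂ :=
  Matrix.of fun i j => S i j / (1 - Complex.exp (T * d i) * star (Complex.exp (T * d j)))

lemma norm_exp_mul_lt_one {T : ℝ} (hT : 0 < T) {z w : ℂ} (hz : z.re < 0) (hw : w.re < 0) :
    ‖Complex.exp (T * z) * star (Complex.exp (T * w))‖ < 1 := by
  rw [norm_mul, norm_star, Complex.norm_exp, Complex.norm_exp, ← Real.exp_add,
    Real.exp_lt_one_iff]
  simp only [Complex.re_ofReal_mul]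
  nlinarith

/-- Entry (i, j) is a geometric series of ratio e^{T d_i} conj(e^{T d_j}), whose modulus is below
one by stability. -/
lemma hasSum_modalGramian (hd : ∀ i, (d i).re < 0) {T : ℝ} (hT : 0 < T)
    (S : Matrix (Fin n) (Fin n) ℂ) :
    HasSum (fun k : ℕ => diagonal (fun i => Complex.exp (T * d i) ^ k) * S *
      (diagonal (fun i => Complex.exp (T * d i) ^ k))ᴴ) (modalGramian d T S) := by
  refine Pi.hasSum.mpr fun i => Pi.hasSum.mpr fun j => ?_
  have h := (hasSum_geometric_of_norm_lt_one
    (norm_exp_mul_lt_one hT (hd i) (hd j))).mul_left (S i j)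
  simp only [diagonal_conjTranspose, Matrix.mul_diagonal, Matrix.diagonal_mul]
  rw [← div_eq_mul_inv] at h
  refine (congrArg (HasSum · _) (funext fun k => ?_)).mpr h
  rw [mul_pow, Pi.star_apply, star_pow]
  ring

lemma posSemidef_modalGramian (hd : ∀ i, (d i).re < 0) {T : ℝ} (hT : 0 < T)
    {S : Matrix (Fin n) (Fin n) ℂ} (hS : S.PosSemidef) : (modalGramian d T S).PosSemidef :=
  posSemidef_of_hasSum (fun _ => hS.mul_mul_conjTranspose_same _) (hasSum_modalGramian hd hT S)

/-- This is the discrete Lyapunov equation W = S + E W E†. It exposes the denominator of the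
information as the same Gramian after one more window of decay. -/
lemma modalGramian_sub (hd : ∀ i, (d i).re < 0) {T : ℝ} (hT : 0 < T)
    (S : Matrix (Fin n) (Fin n) ℂ) :
    modalGramian d T S - S = diagonal (fun i => Complex.exp (T * d i)) * modalGramian d T S *
      (diagonal (fun i => Complex.exp (T * d i)))ᴴ := by
  ext i j
  have h := norm_exp_mul_lt_one hT (hd i) (hd j)
  have hne : 1 - Complex.exp (T * d i) * star (Complex.exp (T * d j)) ≠ 0 := by
    intro h0
    rw [← sub_eq_zero.mp h0] at h
    simp at h
  simp only [diagonal_conjTranspose, Matrix.mul_diagonal, Matrix.diagonal_mul, Matrix.sub_apply,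
    modalGramian, Matrix.of_apply, Pi.star_apply]
  field_simp
  ring

lemma toComplex_ctrlGramian (hU : U ∈ Matrix.unitaryGroup (Fin n) ℂ)
    (hA : toComplex A = Uᴴ * diagonal d * U) (hd : ∀ i, (d i).re < 0) {T : ℝ} (hT : 0 < T)
    {S : Matrix (Fin n) (Fin n) ℝ} {S' : Matrix (Fin n) (Fin n) ℂ}
    (hS : toComplex S = Uᴴ * S' * U) :
    toComplex (ctrlGramian A (1 : Matrix (Fin n) (Fin n) ℝ) T S) =
      Uᴴ * modalGramian d T S' * U := by
  set f : ℕ → Matrix (Fin n) (Fin n) ℝ := fun k =>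
    NormedSpace.exp (((k : ℝ) * T) • A) * ((1 : Matrix (Fin n) (Fin n) ℝ) * S *
      (1 : Matrix (Fin n) (Fin n) ℝ).transpose) *
      NormedSpace.exp (((k : ℝ) * T) • A.transpose) with hf
  have hterm : ∀ k, toComplex (f k) = Uᴴ * (diagonal (fun i => Complex.exp (T * d i) ^ k) * S' *
      (diagonal (fun i => Complex.exp (T * d i) ^ k))ᴴ) * U := fun k => by
    rw [hf]
    simp only [transpose_one, Matrix.one_mul, Matrix.mul_one]
    rw [toComplex_mul, toComplex_mul, hS, toComplex_exp_smul hU hA,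
      toComplex_exp_smul hU (toComplex_transpose_conj hA), conj_mul_conj hU, conj_mul_conj hU,
      diagonal_conjTranspose]
    congr 4
    · congr 1
      ext i
      rw [← Complex.exp_nat_mul]
      push_cast
      ring_nf
    · ext i
      rw [Pi.star_apply, ← Complex.exp_nat_mul, Complex.star_def,
        ← Complex.exp_conj]
      congr 1
      simp
      ring
  have hsumC : HasSum (fun k => toComplex (f k)) (Uᴴ * modalGramian d T S' * U) := by
    simp_rw [hterm]
    exact ((hasSum_modalGramian hd hT S').mul_left _).mul_right _
  -- The real series must be shown summable, since otherwise the `tsum` in `ctrlGramian` would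
  -- default to zero. Summability descends entrywise from the complex series.
  have hsum : Summable f := by
    refine Pi.summable.mpr fun i => Pi.summable.mpr fun j => ?_
    have h := Pi.summable.mp (Pi.summable.mp hsumC.summable i) j
    exact Complex.summable_ofReal.mp h
  have h := hsum.hasSum.map (algebraMap ℝ ℂ).mapMatrix continuous_toComplex
  exact h.unique hsumC

end Unitary

end InfoRate

namespace InfoRate

open Matrix
open scoped ComplexOrder

/-! ### The determinants in modal coordinates. -/

section Modal

/-- Eigenvalue of `e^{(A + Aᵀ) T}` at an eigenvalue `z` of `A`. -/
noncomputable def modalDecay (T : ℝ) (z : ℂ) : ℝ := Real.exp (2 * T * z.re)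

/-- Eigenvalue of the observability Gramian at an eigenvalue `z` of `A`. -/
noncomputable def modalGain (T : ℝ) (z : ℂ) : ℝ := (1 - modalDecay T z) / (-2 * z.re)

/-- Noise covariance plus controllability Gramian, referred to the modes. -/
noncomputable def modalCov {n : ℕ} (d : Fin n → ℂ) (T σ : ℝ) (S : Matrix (Fin n) (Fin n) ℂ) :
    Matrix (Fin n) (Fin n) ℂ :=
  diagonal (fun i => ((σ ^ 2 / modalGain T (d i) : ℝ) : ℂ)) + modalGramian d T S

/-- Excess noise of a mode caused by one window of decay. -/
noncomputable def modalExcess (T σ : ℝ) (z : ℂ) : ℝ :=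
  σ ^ 2 / modalGain T z * (1 / modalDecay T z - 1)

variable {T σ : ℝ} {z : ℂ}

lemma modalDecay_pos : 0 < modalDecay T z := Real.exp_pos _

lemma modalDecay_lt_one (hT : 0 < T) (hz : z.re < 0) : modalDecay T z < 1 := exp_re_lt_one hT hz

lemma modalGain_pos (hT : 0 < T) (hz : z.re < 0) : 0 < modalGain T z :=
  div_pos (sub_pos.mpr (modalDecay_lt_one hT hz)) (by linarith)

lemma modalExcess_pos (hT : 0 < T) (hσ : 0 < σ) (hz : z.re < 0) : 0 < modalExcess T σ z := by
  have h1 := modalGain_pos hT hz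
  have h2 : 0 < 1 / modalDecay T z - 1 :=
    sub_pos.mpr (one_lt_one_div modalDecay_pos (modalDecay_lt_one hT hz))
  unfold modalExcess
  positivity

lemma exp_mul_star_exp (T : ℝ) (z : ℂ) :
    Complex.exp (T * z) * star (Complex.exp (T * z)) = (modalDecay T z : ℂ) := by
  rw [Complex.star_def, ← Complex.exp_conj, ← Complex.exp_add, modalDecay, Complex.ofReal_exp,
    map_mul, Complex.conj_ofReal, ← mul_add, Complex.add_conj]
  push_cast
  ring_nf

variable {n : ℕ} {d : Fin n → ℂ} {S' : Matrix (Fin n) (Fin n) ℂ}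

lemma posDef_modalCov (hd : ∀ i, (d i).re < 0) (hT : 0 < T) (hσ : 0 < σ) (hS : S'.PosSemidef) :
    (modalCov d T σ S').PosDef := by
  refine PosDef.add_posSemidef (PosDef.diagonal fun i => ?_) (posSemidef_modalGramian hd hT hS)
  have := modalGain_pos hT (hd i)
  exact Complex.zero_lt_real.mpr (by positivity)

lemma modalGramian_diag_re (i : Fin n) :
    (modalGramian d T S' i i).re = (S' i i).re / (1 - modalDecay T (d i)) := by
  simp only [modalGramian, Matrix.of_apply]
  rw [exp_mul_star_exp, ← Complex.ofReal_one, ← Complex.ofReal_sub, Complex.div_ofReal_re]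

/-- The Gramian rescales every entry by a nonzero factor, so diagonality passes between it and the
covariance. -/
lemma modalGramian_apply_eq_zero_iff (hd : ∀ i, (d i).re < 0) (hT : 0 < T) (i j : Fin n) :
    modalGramian d T S' i j = 0 ↔ S' i j = 0 := by
  have h := norm_exp_mul_lt_one hT (hd i) (hd j)
  have hne : 1 - Complex.exp (T * d i) * star (Complex.exp (T * d j)) ≠ 0 := by
    intro h0
    rw [← sub_eq_zero.mp h0] at h
    simp at h
  simp only [modalGramian, Matrix.of_apply]
  rw [div_eq_zero_iff, or_iff_left hne]

lemma modalCov_apply_of_ne {i j : Fin n} (hij : i ≠ j) :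
    modalCov d T σ S' i j = modalGramian d T S' i j := by
  simp [modalCov, hij]

/-- The factor of a mode in the ratio of determinants, for a diagonal covariance. -/
lemma modal_ratio (hd : ∀ i, (d i).re < 0) (hT : 0 < T) (hσ : 0 < σ) (hS : S'.PosSemidef)
    (i : Fin n) :
    ((S' i i).re / σ ^ 2 - 2 * (d i).re) /
        ((S' i i).re / σ ^ 2 * Real.exp (2 * T * (d i).re) - 2 * (d i).re) =
      (modalDecay T (d i) * (1 + modalExcess T σ (d i) / (modalCov d T σ S' i i).re))⁻¹ := by
  have hs : 0 ≤ (S' i i).re := (Complex.nonneg_iff.mp (hS.diag_nonneg (i := i))).1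
  have hq := modalDecay_pos (T := T) (z := d i)
  have hq1 := sub_pos.mpr (modalDecay_lt_one hT (hd i))
  have hcov : (modalCov d T σ S' i i).re =
      ((S' i i).re + σ ^ 2 * (-2 * (d i).re)) / (1 - modalDecay T (d i)) := by
    rw [modalCov, Matrix.add_apply, Complex.add_re, modalGramian_diag_re, diagonal_apply_eq,
      Complex.ofReal_re, modalGain, div_div_eq_mul_div, ← add_div, add_comm]
  have hexc : modalExcess T σ (d i) = σ ^ 2 * (-2 * (d i).re) / modalDecay T (d i) := by
    rw [modalExcess, modalGain]
    field_simp
  rw [hcov, hexc]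
  change _ / ((S' i i).re / σ ^ 2 * modalDecay T (d i) - _) = _
  generalize modalDecay T (d i) = q at *
  generalize (S' i i).re = s at *
  obtain ⟨a, ha⟩ : ∃ a, a = -2 * (d i).re := ⟨_, rfl⟩
  have ha0 : 0 < a := by have := hd i; linarith
  rw [show (2 : ℝ) * (d i).re = -a by linarith, ← ha, sub_neg_eq_add, sub_neg_eq_add]
  field_simp
  ring

/-- With G = diag(g_i), the first matrix is G Y and the second is G E (Y + N) E†: pulling E out
turns the noise σ²/g_i into σ²/(g_i q_i), and N_i is the excess over σ²/g_i. -/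
lemma det_noise_add_modalGramian (hd : ∀ i, (d i).re < 0) (hT : 0 < T) (hσ : 0 < σ) :
    (((σ ^ 2 : ℝ) : ℂ) • (1 : Matrix (Fin n) (Fin n) ℂ) +
        diagonal (fun i => (modalGain T (d i) : ℂ)) * modalGramian d T S').det =
      ((∏ i, modalGain T (d i) : ℝ) : ℂ) * (modalCov d T σ S').det ∧
    (((σ ^ 2 : ℝ) : ℂ) • (1 : Matrix (Fin n) (Fin n) ℂ) +
        diagonal (fun i => (modalGain T (d i) : ℂ)) * (modalGramian d T S' - S')).det =
      ((∏ i, modalGain T (d i) : ℝ) : ℂ) * ((∏ i, modalDecay T (d i) : ℝ) : ℂ) *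
        (modalCov d T σ S' + diagonal fun i => (modalExcess T σ (d i) : ℂ)).det := by
  have hg : ∀ i, (modalGain T (d i) : ℂ) ≠ 0 := fun i =>
    Complex.ofReal_ne_zero.mpr (modalGain_pos hT (hd i)).ne'
  have hq : ∀ i, (modalDecay T (d i) : ℂ) ≠ 0 := fun i =>
    Complex.ofReal_ne_zero.mpr modalDecay_pos.ne'
  have h1 : ((σ ^ 2 : ℝ) : ℂ) • (1 : Matrix (Fin n) (Fin n) ℂ) +
        diagonal (fun i => (modalGain T (d i) : ℂ)) * modalGramian d T S' =
      diagonal (fun i => (modalGain T (d i) : ℂ)) * modalCov d T σ S' := by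
    rw [modalCov, Matrix.mul_add, diagonal_mul_diagonal, smul_one_eq_diagonal]
    congr 2
    ext i
    have := hg i
    push_cast
    field_simp
  have h2 : ((σ ^ 2 : ℝ) : ℂ) • (1 : Matrix (Fin n) (Fin n) ℂ) +
        diagonal (fun i => (modalGain T (d i) : ℂ)) * (modalGramian d T S' - S') =
      diagonal (fun i => (modalGain T (d i) : ℂ)) * (diagonal (fun i => Complex.exp (T * d i)) *
        (modalCov d T σ S' + diagonal fun i => (modalExcess T σ (d i) : ℂ)) *
        (diagonal (fun i => Complex.exp (T * d i)))ᴴ) := by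
    rw [modalGramian_sub hd hT, modalCov, add_right_comm, Matrix.mul_add (diagonal _),
      Matrix.add_mul, Matrix.mul_add (diagonal _), diagonal_add, diagonal_conjTranspose,
      diagonal_mul_diagonal, diagonal_mul_diagonal, diagonal_mul_diagonal, smul_one_eq_diagonal]
    congr 2
    ext i
    have := hg i
    have := hq i
    rw [Pi.star_apply, mul_right_comm (Complex.exp _), exp_mul_star_exp, modalExcess]
    push_cast
    field_simp
    ring
  constructor
  · rw [h1, det_mul, det_diagonal, Complex.ofReal_prod]
  · rw [h2, det_mul, det_mul, det_mul, diagonal_conjTranspose, det_diagonal, det_diagonal,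
      det_diagonal, Complex.ofReal_prod, Complex.ofReal_prod, mul_right_comm (∏ i, _),
      ← Finset.prod_mul_distrib, mul_assoc]
    simp only [Pi.star_apply, exp_mul_star_exp]

end Modal

/-! ### Information against the sum of the scalar rates. -/

section Info

variable {n : ℕ} {T σ : ℝ} {U : Matrix (Fin n) (Fin n) ℂ} {d : Fin n → ℂ}
  {A S : Matrix (Fin n) (Fin n) ℝ} {S' : Matrix (Fin n) (Fin n) ℂ}

lemma info_eq_modal (hU : U ∈ Matrix.unitaryGroup (Fin n) ℂ)
    (hA : toComplex A = Uᴴ * diagonal d * U) (hd : ∀ i, (d i).re < 0) (hT : 0 < T) (hσ : 0 < σ)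
    (hS : toComplex S = Uᴴ * S' * U) (hS' : S'.PosSemidef) :
    info A (1 : Matrix (Fin n) (Fin n) ℝ) (1 : Matrix (Fin n) (Fin n) ℝ) T σ S =
      1 / 2 * Real.logb 2 ((∏ i, modalDecay T (d i)) *
        ((modalCov d T σ S' + diagonal fun i => (modalExcess T σ (d i) : ℂ)).det.re /
          (modalCov d T σ S').det.re))⁻¹ := by
  have hY := posDef_modalCov hd hT hσ hS'
  have hYN := posDef_add_diagonal_nonneg hY fun i => (modalExcess_pos hT hσ (hd i)).le
  have hdet : ∀ (M : Matrix (Fin n) (Fin n) ℝ) (M' : Matrix (Fin n) (Fin n) ℂ),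
      toComplex M = Uᴴ * M' * U →
      ((σ ^ 2 • (1 : Matrix (Fin n) (Fin n) ℝ) + obsGramian A 1 T * M).det : ℂ) =
        (((σ ^ 2 : ℝ) : ℂ) • (1 : Matrix (Fin n) (Fin n) ℂ) +
          diagonal (fun i => (modalGain T (d i) : ℂ)) * M').det := fun M M' hM => by
    rw [← toComplex_det, toComplex_add, toComplex_smul, toComplex_one, toComplex_mul, hM,
      toComplex_obsGramian hU hA hd, conj_mul_conj hU,
      ← det_conj hU (_ + diagonal (fun i => (modalGain T (d i) : ℂ)) * M')]
    congr 1
    rw [Matrix.mul_add, Matrix.add_mul, Matrix.mul_smul, Matrix.smul_mul, Matrix.mul_one,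
      unitary_conjTranspose_mul hU]
    rfl
  have hW := toComplex_ctrlGramian hU hA hd hT hS
  have h1 := hdet _ _ hW
  have h2 := hdet (ctrlGramian A 1 T S - (1 : Matrix (Fin n) (Fin n) ℝ) * S *
      (1 : Matrix (Fin n) (Fin n) ℝ).transpose) (modalGramian d T S' - S') (by
    rw [transpose_one, Matrix.one_mul, Matrix.mul_one, toComplex_sub, hW, hS, Matrix.mul_sub,
      Matrix.sub_mul])
  rw [(det_noise_add_modalGramian hd hT hσ).1, ← posDef_coe_det_re hY, ← Complex.ofReal_mul,
    Complex.ofReal_inj] at h1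
  rw [(det_noise_add_modalGramian hd hT hσ).2, ← posDef_coe_det_re hYN, ← Complex.ofReal_mul,
    ← Complex.ofReal_mul, Complex.ofReal_inj] at h2
  rw [info, h1, h2]
  have hg : 0 < ∏ i, modalGain T (d i) := Finset.prod_pos fun i _ => modalGain_pos hT (hd i)
  have hq : 0 < ∏ i, modalDecay T (d i) := Finset.prod_pos fun i _ => modalDecay_pos
  have hY' := posDef_det_re_pos hY
  have hYN' := posDef_det_re_pos hYN
  congr 2
  field_simp

lemma sum_scalarRate_eq_modal (hd : ∀ i, (d i).re < 0) (hT : 0 < T) (hσ : 0 < σ)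
    (hS' : S'.PosSemidef) :
    T * ∑ i, scalarRate T σ (S' i i).re (d i) =
      1 / 2 * Real.logb 2 ((∏ i, modalDecay T (d i)) *
        ∏ i, (1 + modalExcess T σ (d i) / (modalCov d T σ S' i i).re))⁻¹ := by
  have hY := posDef_modalCov hd hT hσ hS'
  have hpos : ∀ i, 0 < 1 + modalExcess T σ (d i) / (modalCov d T σ S' i i).re := fun i => by
    have := div_pos (modalExcess_pos hT hσ (hd i)) (posDef_diag_re_pos hY i)
    linarith
  rw [← Finset.prod_mul_distrib, ← Finset.prod_inv_distrib, Real.logb_prod, Finset.mul_sum,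
    Finset.mul_sum]
  · refine Finset.sum_congr rfl fun i _ => ?_
    rw [scalarRate, modal_ratio hd hT hσ hS' i]
    field_simp
  · exact fun i _ => (inv_pos.mpr (mul_pos modalDecay_pos (hpos i))).ne'

/-- The information is at most that of the independent modes, with equality exactly when the
covariance is diagonal in the eigenbasis. -/
lemma info_le_sum_scalarRate (hU : U ∈ Matrix.unitaryGroup (Fin n) ℂ)
    (hA : toComplex A = Uᴴ * diagonal d * U) (hd : ∀ i, (d i).re < 0) (hT : 0 < T) (hσ : 0 < σ)
    (hS : toComplex S = Uᴴ * S' * U) (hS' : S'.PosSemidef) :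
    info A (1 : Matrix (Fin n) (Fin n) ℝ) (1 : Matrix (Fin n) (Fin n) ℝ) T σ S ≤
        T * ∑ i, scalarRate T σ (S' i i).re (d i) ∧
      (info A (1 : Matrix (Fin n) (Fin n) ℝ) (1 : Matrix (Fin n) (Fin n) ℝ) T σ S =
        T * ∑ i, scalarRate T σ (S' i i).re (d i) ↔ S'.IsDiag) := by
  rw [info_eq_modal hU hA hd hT hσ hS hS', sum_scalarRate_eq_modal hd hT hσ hS']
  have hY := posDef_modalCov hd hT hσ hS'
  have hYN := posDef_add_diagonal_nonneg hY fun i => (modalExcess_pos hT hσ (hd i)).le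
  have hfischer := prod_le_det_add_diagonal_div_det hY
    (fun i => modalExcess_pos hT hσ (hd i)) Finset.univ
  simp only [Finset.mem_univ, if_true, forall_const] at hfischer
  have hq : 0 < ∏ i, modalDecay T (d i) := Finset.prod_pos fun i _ => modalDecay_pos
  have hR := div_pos (posDef_det_re_pos hYN) (posDef_det_re_pos hY)
  have hprod : 0 < ∏ i, (1 + modalExcess T σ (d i) / (modalCov d T σ S' i i).re) :=
    Finset.prod_pos fun i _ => by
      have := div_pos (modalExcess_pos hT hσ (hd i)) (posDef_diag_re_pos hY i)
      linarith
  refine ⟨?_, fun heq => ?_, fun hdiag => ?_⟩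
  · refine mul_le_mul_of_nonneg_left (Real.logb_le_logb_of_le one_lt_two
      (inv_pos.mpr (mul_pos hq hR)) ?_) (by norm_num)
    exact inv_anti₀ (mul_pos hq hprod) (mul_le_mul_of_nonneg_left hfischer.1 hq.le)
  · have h1 := mul_left_cancel₀ (by norm_num : (1 / 2 : ℝ) ≠ 0) heq
    have h2 := Real.logb_injOn_pos one_lt_two (Set.mem_Ioi.mpr (inv_pos.mpr (mul_pos hq hR)))
      (Set.mem_Ioi.mpr (inv_pos.mpr (mul_pos hq hprod))) h1
    have h3 := mul_left_cancel₀ hq.ne' (inv_injective h2)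
    intro i j hij
    have h4 := hfischer.2 h3.symm j i hij
    rwa [modalCov_apply_of_ne hij, modalGramian_apply_eq_zero_iff hd hT] at h4
  · have hYdiag : modalCov d T σ S' =
        diagonal fun i => (((modalCov d T σ S') i i).re : ℂ) := by
      ext i j
      by_cases hij : i = j
      · subst hij
        rw [diagonal_apply_eq, posDef_coe_diag_re hY]
      · rw [diagonal_apply_ne _ hij, modalCov_apply_of_ne hij,
          modalGramian_apply_eq_zero_iff hd hT]
        exact hdiag hij
    have h1 : (modalCov d T σ S').det.re = ∏ i, (modalCov d T σ S' i i).re := by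
      conv_lhs => rw [hYdiag]
      rw [det_diagonal, ← Complex.ofReal_prod, Complex.ofReal_re]
    have h2 : (modalCov d T σ S' + diagonal fun i => (modalExcess T σ (d i) : ℂ)).det.re =
        ∏ i, ((modalCov d T σ S' i i).re + modalExcess T σ (d i)) := by
      conv_lhs => rw [hYdiag]
      rw [diagonal_add, det_diagonal]
      simp only [← Complex.ofReal_add]
      rw [← Complex.ofReal_prod, Complex.ofReal_re]
    rw [h1, h2, ← Finset.prod_div_distrib]
    congr 4
    refine Finset.prod_congr rfl fun i _ => ?_
    rw [add_div, div_self (posDef_diag_re_pos hY i).ne']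

end Info

end InfoRate

/-! ### Eigenvalue lists and realization of allocations by real covariances. -/

namespace InfoRate

open Matrix
open scoped ComplexOrder

/-- Both families have the same multiset of roots, hence fibres of equal size over each value;
bijections between the fibres glue to a permutation. -/
lemma exists_perm_of_prod_X_sub_C_eq {n : ℕ} {d l : Fin n → ℂ}
    (h : ∏ i, (Polynomial.X - Polynomial.C (d i)) = ∏ i, (Polynomial.X - Polynomial.C (l i))) :
    ∃ e : Equiv.Perm (Fin n), ∀ i, l (e i) = d i := by
  classical
  have hroots : ∀ f : Fin n → ℂ, (∏ i, (Polynomial.X - Polynomial.C (f i))).roots =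
      Finset.univ.val.map f := fun f => by
    have := Polynomial.roots_multiset_prod_X_sub_C (Finset.univ.val.map f)
    rwa [Multiset.map_map] at this
  have hmap : Finset.univ.val.map d = Finset.univ.val.map l := by
    rw [← hroots, ← hroots, h]
  have hcard : ∀ c, Fintype.card {i // d i = c} = Fintype.card {i // l i = c} := fun c => by
    have := congrArg (Multiset.count c) hmap
    rw [Multiset.count_map, Multiset.count_map] at this
    rw [Fintype.card_subtype, Fintype.card_subtype]
    simpa [Finset.card, eq_comm] using this
  exact ⟨Equiv.ofFiberEquiv fun c => Fintype.equivOfCardEq (hcard c),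
    fun i => Equiv.ofFiberEquiv_map _ i⟩

section Realization

variable {n : ℕ} {U : Matrix (Fin n) (Fin n) ℂ} {A : Matrix (Fin n) (Fin n) ℝ} {d : Fin n → ℂ}

lemma exists_perm_of_isEigenvalueList (hU : U ∈ Matrix.unitaryGroup (Fin n) ℂ)
    (hA : toComplex A = Uᴴ * diagonal d * U) {l : Fin n → ℂ} (hl : IsEigenvalueList A l) :
    ∃ e : Equiv.Perm (Fin n), ∀ i, l (e i) = d i := by
  refine exists_perm_of_prod_X_sub_C_eq ?_
  rw [← hl, hA, Matrix.charpoly_mul_comm, ← Matrix.mul_assoc, unitary_mul_conjTranspose hU,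
    Matrix.one_mul, Matrix.charpoly_diagonal]

lemma re_neg_of_isEigenvalueList (hstable : IsStable A) {l : Fin n → ℂ}
    (hl : IsEigenvalueList A l) (i : Fin n) : (l i).re < 0 := by
  refine hstable _ (Matrix.mem_spectrum_iff_isRoot_charpoly.mpr ?_)
  rw [hl, Polynomial.IsRoot, Polynomial.eval_prod]
  exact Finset.prod_eq_zero (Finset.mem_univ i) (by simp)

lemma toComplex_aeval (hU : U ∈ Matrix.unitaryGroup (Fin n) ℂ) {m : Fin n → ℝ}
    (hA : toComplex A = Uᴴ * diagonal (fun i => (m i : ℂ)) * U) (g : Polynomial ℝ) :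
    toComplex (Polynomial.aeval A g) = Uᴴ * diagonal (fun i => ((g.eval (m i) : ℝ) : ℂ)) * U := by
  induction g using Polynomial.induction_on with
  | C a =>
    rw [Polynomial.aeval_C, Algebra.algebraMap_eq_smul_one, toComplex_smul, toComplex_one]
    simp only [Polynomial.eval_C]
    rw [← smul_one_eq_diagonal, Matrix.mul_smul, Matrix.smul_mul, Matrix.mul_one,
      unitary_conjTranspose_mul hU]
  | add p q hp hq =>
    rw [map_add, toComplex_add, hp, hq, ← Matrix.add_mul, ← Matrix.mul_add, diagonal_add]
    simp only [Polynomial.eval_add, Complex.ofReal_add]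
  | monomial k a ih =>
    rw [pow_succ, ← mul_assoc, map_mul, Polynomial.aeval_X, toComplex_mul, ih, hA,
      conj_mul_conj hU, diagonal_mul_diagonal]
    simp only [Polynomial.eval_mul, Polynomial.eval_X, Complex.ofReal_mul]

lemma exists_polynomial_eval_eq {m p : Fin n → ℝ} (h : ∀ i j, m i = m j → p i = p j) :
    ∃ g : Polynomial ℝ, ∀ i, g.eval (m i) = p i := by
  classical
  -- The nodes are the distinct values of m, on which p is well defined by `h`; the default 0 of the
  -- extension is never evaluated at a node.
  refine ⟨Lagrange.interpolate (Finset.univ.image m) id (Function.extend m p 0), fun i => ?_⟩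
  have h1 := Lagrange.eval_interpolate_at_node (s := Finset.univ.image m) (v := id)
    (Function.extend m p 0) Function.injective_id.injOn
    (Finset.mem_image_of_mem m (Finset.mem_univ i))
  have h2 : Function.FactorsThrough p m := fun i j hij => h i j hij
  rw [h2.extend_apply] at h1
  exact h1

/-- A power allocation that depends only on the decay rates is realized by a real covariance. -/
lemma exists_admissible_of_allocation (hU : U ∈ Matrix.unitaryGroup (Fin n) ℂ)
    (hA : toComplex A = Uᴴ * diagonal d * U) {P : ℝ} {p : Fin n → ℝ} (hp : p ∈ allocations n P)
    (h : ∀ i j, (d i).re = (d j).re → p i = p j) :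
    ∃ S ∈ admissible n P, toComplex S = Uᴴ * diagonal (fun i => (p i : ℂ)) * U := by
  -- The real matrix `A + Aᵀ` has eigenvalues 2 Re d_i in the same eigenbasis, so a real polynomial
  -- in it can take any values that depend only on Re d_i.
  obtain ⟨g, hg⟩ := exists_polynomial_eval_eq (m := fun i => 2 * (d i).re) (p := p)
    fun i j hij => h i j (by linarith)
  have hsum : toComplex (A + A.transpose) =
      Uᴴ * diagonal (fun i => ((2 * (d i).re : ℝ) : ℂ)) * U := by
    rw [toComplex_add, toComplex_transpose_conj hA, hA, ← Matrix.add_mul, ← Matrix.mul_add,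
      diagonal_add]
    simp only [Complex.star_def, Complex.add_conj]
  have hS := toComplex_aeval hU hsum g
  simp only [hg] at hS
  refine ⟨_, ⟨?_, ?_⟩, hS⟩
  · rw [← posSemidef_toComplex_iff, hS]
    exact (PosSemidef.diagonal fun i =>
      Complex.zero_le_real.mpr (hp.1 i)).conjTranspose_mul_mul_same U
  · refine le_of_eq ?_
    rw [← hp.2, ← Complex.ofReal_inj, ← toComplex_trace, hS, trace_conj hU, trace_diagonal,
      Complex.ofReal_sum]

end Realization

/-- In any orthonormal eigenbasis the information of an admissible covariance is at most that of
some power allocation; equality forces the covariance to be diagonal. -/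
lemma exists_allocation_info_le {n : ℕ} (hn : 0 < n) {U : Matrix (Fin n) (Fin n) ℂ}
    {A S : Matrix (Fin n) (Fin n) ℝ} {d l : Fin n → ℂ} {T σ P : ℝ}
    (hU : U ∈ Matrix.unitaryGroup (Fin n) ℂ) (hA : toComplex A = Uᴴ * diagonal d * U)
    (hl : IsEigenvalueList A l) (hneg : ∀ i, (l i).re < 0) (hT : 0 < T) (hσ : 0 < σ)
    (hS : S ∈ admissible n P) :
    ∃ p ∈ allocations n P,
      info A (1 : Matrix (Fin n) (Fin n) ℝ) (1 : Matrix (Fin n) (Fin n) ℝ) T σ S ≤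
          T * ∑ i, scalarRate T σ (p i) (l i) ∧
        (T * ∑ i, scalarRate T σ (p i) (l i) ≤
            info A (1 : Matrix (Fin n) (Fin n) ℝ) (1 : Matrix (Fin n) (Fin n) ℝ) T σ S →
          (U * toComplex S * Uᴴ).IsDiag) := by
  obtain ⟨e, he⟩ := exists_perm_of_isEigenvalueList hU hA hl
  have hd : ∀ i, (d i).re < 0 := fun i => he i ▸ hneg (e i)
  have hS' : (U * toComplex S * Uᴴ).PosSemidef :=
    (posSemidef_toComplex_iff.mpr hS.1).mul_mul_conjTranspose_same U
  have hconj := (eq_conj_iff hU (M := toComplex S)).mpr rfl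
  have hmain := info_le_sum_scalarRate hU hA hd hT hσ hconj hS'
  set S' := U * toComplex S * Uᴴ
  have hsum : ∑ i, scalarRate T σ (S' i i).re (d i) =
      ∑ i, scalarRate T σ (S' (e.symm i) (e.symm i)).re (l i) := by
    rw [← Equiv.sum_comp e fun i => scalarRate T σ (S' (e.symm i) (e.symm i)).re (l i)]
    exact Finset.sum_congr rfl fun i _ => by rw [Equiv.symm_apply_apply, he]
  have htrace : ∑ i, (S' (e.symm i) (e.symm i)).re ≤ P := by
    rw [Equiv.sum_comp e.symm fun i => (S' i i).re, ← Complex.re_sum]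
    have h1 := trace_conj hU S'
    rw [← hconj, toComplex_trace] at h1
    change S'.trace.re ≤ P
    rw [← h1, Complex.ofReal_re]
    exact hS.2
  -- The diagonal of the covariance in the eigenbasis, reindexed to match `l`, is a power profile
  -- whose total is the trace, hence at most P.
  obtain ⟨p, hp, hle⟩ := exists_allocation_ge hn hT hσ hneg
    (fun i => (Complex.nonneg_iff.mp (hS'.diag_nonneg (i := e.symm i))).1) htrace
  rw [← hsum] at hle
  have hle' := mul_le_mul_of_nonneg_left hle hT.le
  exact ⟨p, hp, hmain.1.trans hle', fun h => hmain.2.mp (le_antisymm hmain.1 (hle'.trans h))⟩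

/-- Some covariance attains the optimum over the power allocations. -/
lemma exists_admissible_info_eq {n : ℕ} {U : Matrix (Fin n) (Fin n) ℂ}
    {A : Matrix (Fin n) (Fin n) ℝ} {d l : Fin n → ℂ} {T σ P : ℝ}
    (hU : U ∈ Matrix.unitaryGroup (Fin n) ℂ) (hA : toComplex A = Uᴴ * diagonal d * U)
    (hl : IsEigenvalueList A l) (hneg : ∀ i, (l i).re < 0) (hT : 0 < T) (hσ : 0 < σ)
    {p : Fin n → ℝ} (hp : p ∈ allocations n P)
    (hmax : ∀ p' ∈ allocations n P,
      ∑ i, scalarRate T σ (p' i) (l i) ≤ ∑ i, scalarRate T σ (p i) (l i)) :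
    ∃ S ∈ admissible n P,
      info A (1 : Matrix (Fin n) (Fin n) ℝ) (1 : Matrix (Fin n) (Fin n) ℝ) T σ S =
        T * ∑ i, scalarRate T σ (p i) (l i) := by
  obtain ⟨e, he⟩ := exists_perm_of_isEigenvalueList hU hA hl
  have hd : ∀ i, (d i).re < 0 := fun i => he i ▸ hneg (e i)
  have hpe : (fun i => p (e i)) ∈ allocations n P :=
    ⟨fun i => hp.1 _, by rw [Equiv.sum_comp e p, hp.2]⟩
  obtain ⟨S, hS, hSe⟩ := exists_admissible_of_allocation hU hA hpe fun i j hij =>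
    optimal_allocation_eq_of_re_eq hT hσ hneg hp hmax (by rw [he, he, hij])
  refine ⟨S, hS, ?_⟩
  have hpsd : (diagonal fun i => (p (e i) : ℂ)).PosSemidef :=
    PosSemidef.diagonal fun i => Complex.zero_le_real.mpr (hp.1 (e i))
  rw [(info_le_sum_scalarRate hU hA hd hT hσ hSe hpsd).2.mpr (isDiag_diagonal _),
    ← Equiv.sum_comp e fun i => scalarRate T σ (p i) (l i)]
  simp only [diagonal_apply_eq, Complex.ofReal_re, he]

end InfoRate

/-! ### The optimum and its equality case. -/

theorem mainTheorem3 (n : ℕ) (hn : 0 < n) (A B C : Matrix (Fin n) (Fin n) ℝ)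
    (hB : B = 1) (hC : C = 1)
    (hnormal : A * A.transpose = A.transpose * A) (hstable : InfoRate.IsStable A)
    (l : Fin n → ℂ) (hl : InfoRate.IsEigenvalueList A l)
    (T σ P : ℝ) (hT : 0 < T) (hσ : 0 < σ) (hP : 0 ≤ P) :
    -- the maximum that defines the capacity is attained
    IsGreatest (InfoRate.info A B C T σ '' InfoRate.admissible n P)
      (InfoRate.capacity A B C T σ P) ∧
    -- every optimal covariance is diagonal in every orthonormal eigenbasis of `A`
    (∀ S ∈ InfoRate.admissible n P,
      IsMaxOn (InfoRate.info A B C T σ) (InfoRate.admissible n P) S →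
      ∀ U ∈ Matrix.unitaryGroup (Fin n) ℂ,
        (U * InfoRate.toComplex A * U.conjTranspose).IsDiag →
        (U * InfoRate.toComplex S * U.conjTranspose).IsDiag) ∧
    -- the rate is the maximum over the power allocations of the sum of the scalar rates
    IsGreatest ((fun p : Fin n → ℝ => ∑ i, InfoRate.scalarRate T σ (p i) (l i)) ''
        InfoRate.allocations n P)
      (InfoRate.rate A B C T σ P) := by
  subst hB hC
  have hneg := InfoRate.re_neg_of_isEigenvalueList hstable hl
  obtain ⟨p, hp, hmax⟩ := InfoRate.exists_optimal_allocation (T := T) hn hσ hP hneg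
  have hnormal' : InfoRate.toComplex A * (InfoRate.toComplex A).conjTranspose =
      (InfoRate.toComplex A).conjTranspose * InfoRate.toComplex A := by
    rw [← InfoRate.toComplex_transpose, ← InfoRate.toComplex_mul, ← InfoRate.toComplex_mul, hnormal]
  obtain ⟨U, hU, d, hA⟩ := InfoRate.exists_unitary_diagonalization_of_normal hnormal'
  obtain ⟨S, hS, hSinfo⟩ := InfoRate.exists_admissible_info_eq hU hA hl hneg hT hσ hp hmax
  have hgreatest : IsGreatest (InfoRate.info A (1 : Matrix (Fin n) (Fin n) ℝ)
      (1 : Matrix (Fin n) (Fin n) ℝ) T σ '' InfoRate.admissible n P)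
      (T * ∑ i, InfoRate.scalarRate T σ (p i) (l i)) := by
    refine ⟨⟨S, hS, hSinfo⟩, ?_⟩
    rintro _ ⟨S₁, hS₁, rfl⟩
    obtain ⟨p₁, hp₁, hle, -⟩ := InfoRate.exists_allocation_info_le hn hU hA hl hneg hT hσ hS₁
    exact hle.trans (mul_le_mul_of_nonneg_left (hmax p₁ hp₁) hT.le)
  have hcap : InfoRate.capacity A (1 : Matrix (Fin n) (Fin n) ℝ)
      (1 : Matrix (Fin n) (Fin n) ℝ) T σ P = T * ∑ i, InfoRate.scalarRate T σ (p i) (l i) :=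
    hgreatest.csSup_eq
  refine ⟨hcap ▸ hgreatest, fun S₁ hS₁ hopt V hV hdiag => ?_, ?_⟩
  · have hAV := (InfoRate.eq_conj_iff hV).mpr hdiag.diagonal_diag.symm
    -- The bound is applied again in the given eigenbasis V. Optimality of `S₁` against the
    -- constructed `S` closes the chain of inequalities, and the equality case makes `S₁` diagonal
    -- there.
    obtain ⟨p₁, hp₁, -, himp⟩ := InfoRate.exists_allocation_info_le hn hV hAV hl hneg hT hσ hS₁
    refine himp ((mul_le_mul_of_nonneg_left (hmax p₁ hp₁) hT.le).trans ?_)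
    rw [← hSinfo]
    exact hopt hS
  · rw [InfoRate.rate, hcap, mul_div_cancel_left₀ _ hT.ne']
    refine ⟨⟨p, hp, rfl⟩, ?_⟩
    rintro _ ⟨p₁, hp₁, rfl⟩
    exact hmax p₁ hp₁
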